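/- Let $U\subseteq\mathbb R^5$ be a nonempty connected open set, with coordinates $(x,t,a,b,c)$, where $x,t$ are the independent variables (also called $x_1,x_2$) and $a,b,c$ the dependent variables. Consider the system of PDEs for functions $a,b,c$ of $(x,t)$ (an index $1$ or $2$ denotes differentiation in $x$ or $t$) $$a_{11}-b_{22}=0,\qquad b_{12}+c_{11}=0,\qquad a_{12}+c_{22}=0,$$ $$a_1c_2+a_2b_2-a_2c_1-c_2^2+2c\,a_{12}+b\,a_{22}-a\,c_{12}=0,$$ $$a_2b_1-c_1c_2+c\,a_{11}-a\,c_{11}-c\,c_{12}-b\,c_{22}=0,$$ $$a_1b_1-b_1c_2+b_2c_1-c_1^2+a\,b_{11}+2c\,b_{12}-b\,c_{12}=0,$$ and write it as $\Delta_\mu=0$, $\mu=1,\dots,6$, where the $\Delta_\mu$ are functions on the space of second order jets. An infinitesimal point symmetry of the system on $U$ is a smooth vector field $$X=\xi^1\partial_x+\xi^2\partial_t+\phi_1\partial_a+\phi_2\partial_b+\phi_3\partial_c$$ on $U$, with coefficients depending on $(x,t,a,b,c)$, whose second prolongation satisfies $\mathrm{Pr}^{(2)}X[\Delta_\mu]=0$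 for all $\mu$ at every second order jet over $U$ at which $\Delta_1=\dots=\Delta_6=0$. Here, with $(x^1,x^2)=(x,t)$ and $(u^1,u^2,u^3)=(a,b,c)$, the coefficient of $\partial_{u^\alpha_J}$ in $\mathrm{Pr}^{(2)}X$ is $D_J\bigl(\phi_\alpha-\sum_i\xi^iu^\alpha_i\bigr)+\sum_i\xi^iu^\alpha_{J,i}$, where $D_J$ denotes total derivatives. Then the infinitesimal point symmetries of the system on $U$ form a real Lie algebra of dimension seven under the Lie bracket of vector fields, and a vector field on $U$ is an infinitesimal point symmetry if and only if there are real constants $k_1,\dots,k_7$ such that on $U$ $$\xi^1=k_3x+k_1t+k_2,\qquad \xi^2=k_6x+k_4t+k_5,$$ $$\phi_1=2k_1c+k_7a,\qquad \phi_2=(2k_4-2k_3+k_7)b+2k_6c,\qquad \phi_3=(k_7+k_4-k_3)c+k_6a+k_1b.$$ -/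

import Mathlib

open scoped ContDiff

namespace WalkerSymmetry

/-- The space of independent and dependent variables: a point is `((x, t), (a, b, c))`. -/
abbrev Pt := (Fin 2 → ℝ) × (Fin 3 → ℝ)

/-- First order jets `(x, u, u₁)`. Here and below a partial derivative of order `n` is indexed by
the number `m : Fin (n + 1)` of differentiations in `t` (the other `n - m` ones are in `x`), so the
equality of mixed partial derivatives is built in; `j.2 0 α = u^α_x` and `j.2 1 α = u^α_t`. -/
abbrev Jet1 := Pt × (Fin 2 → Fin 3 → ℝ)

/-- Second order jets; `j.2 0 α = u^α_xx`, `j.2 1 α = u^α_xt`, `j.2 2 α = u^α_tt`. -/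
abbrev Jet2 := Jet1 × (Fin 3 → Fin 3 → ℝ)

/-- Third order jets; `j.2 0 α = u^α_xxx`, ..., `j.2 3 α = u^α_ttt`. -/
abbrev Jet3 := Jet2 × (Fin 4 → Fin 3 → ℝ)

/-- One more differentiation, in `x` if `i = 0` and in `t` if `i = 1`, of a derivative that
contains `m` differentiations in `t`. -/
def shift {n : ℕ} (m : Fin n) (i : Fin 2) : Fin (n + 1) := ⟨m.1 + i.1, by omega⟩

/-- The total derivative vector `∂_i + ∑ u^α_i ∂_{u^α}` on `Pt`. -/
def totalVec0 (i : Fin 2) (j : Jet1) : Pt := (Pi.single i 1, j.2 i)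

/-- The total derivative vector on first order jets,
`∂_i + ∑ u^α_i ∂_{u^α} + ∑ u^α_{k,i} ∂_{u^α_k}`. -/
def totalVec1 (i : Fin 2) (j : Jet2) : Jet1 :=
  (totalVec0 i j.1, fun m => j.2 (shift m i))

/-- The total derivative vector on second order jets. -/
def totalVec2 (i : Fin 2) (j : Jet3) : Jet2 :=
  (totalVec1 i j.1, fun m => j.2 (shift m i))

/-- The total derivative `D_i F` of a function of first order jets (`D_0 = D_x`, `D_1 = D_t`). -/
noncomputable def totalD1 (i : Fin 2) (F : Jet1 → ℝ) (j : Jet2) : ℝ :=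
  fderiv ℝ F j.1 (totalVec1 i j)

/-- The total derivative `D_i F` of a function of second order jets. -/
noncomputable def totalD2 (i : Fin 2) (F : Jet2 → ℝ) (j : Jet3) : ℝ :=
  fderiv ℝ F j.1 (totalVec2 i j)

/-- The characteristic `Q_α = φ_α - ∑ ξ^i u^α_i` of the vector field
`X = ξ¹ ∂_x + ξ² ∂_t + φ₁ ∂_a + φ₂ ∂_b + φ₃ ∂_c`, whose components are
`(X z).1 = (ξ¹, ξ²)` and `(X z).2 = (φ₁, φ₂, φ₃)`. -/
noncomputable def charQ (X : Pt → Pt) (α : Fin 3) (j : Jet1) : ℝ :=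
  (X j.1).2 α - ∑ i : Fin 2, (X j.1).1 i * j.2 i α

/-- The coefficient `φ_α^i = D_i Q_α + ∑ ξ^l u^α_{i,l}` of `∂_{u^α_i}` in the prolongation. -/
noncomputable def prolong1 (X : Pt → Pt) (i : Fin 2) (α : Fin 3) (j : Jet2) : ℝ :=
  totalD1 i (charQ X α) j + ∑ l : Fin 2, (X j.1.1).1 l * j.2 (shift i l) α

/-- The coefficient `φ_α^{ik} = D_i D_k Q_α + ∑ ξ^l u^α_{ik,l}` of `∂_{u^α_{ik}}` in the
prolongation. The third order coordinates cancel in it. -/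
noncomputable def prolong2 (X : Pt → Pt) (i k : Fin 2) (α : Fin 3) (j : Jet3) : ℝ :=
  totalD2 i (totalD1 k (charQ X α)) j +
    ∑ l : Fin 2, (X j.1.1.1).1 l * j.2 (shift (shift i k) l) α

/-- The second prolongation `Pr⁽²⁾ X`, as a vector on the space of second order jets. -/
noncomputable def prolongation (X : Pt → Pt) (j : Jet3) : Jet2 :=
  ((X j.1.1.1, fun i α => prolong1 X i α j.1),
    ![fun α => prolong2 X 0 0 α j, fun α => prolong2 X 0 1 α j, fun α => prolong2 X 1 1 α j])

/-- The left-hand sides of the six equations of the system, as functions on second order jets.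
The dependent variables are `a`, `b`, `c`; an index `1` stands for `x` and `2` for `t`. -/
def system (j : Jet2) : Fin 6 → ℝ :=
  let a := j.1.1.2 0
  let b := j.1.1.2 1
  let c := j.1.1.2 2
  let a₁ := j.1.2 0 0
  let b₁ := j.1.2 0 1
  let c₁ := j.1.2 0 2
  let a₂ := j.1.2 1 0
  let b₂ := j.1.2 1 1
  let c₂ := j.1.2 1 2
  let a₁₁ := j.2 0 0
  let b₁₁ := j.2 0 1
  let c₁₁ := j.2 0 2
  let a₁₂ := j.2 1 0
  let b₁₂ := j.2 1 1
  let c₁₂ := j.2 1 2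
  let a₂₂ := j.2 2 0
  let b₂₂ := j.2 2 1
  let c₂₂ := j.2 2 2
  ![a₁₁ - b₂₂,
    b₁₂ + c₁₁,
    a₁₂ + c₂₂,
    a₁ * c₂ + a₂ * b₂ - a₂ * c₁ - c₂ ^ 2 + 2 * c * a₁₂ + b * a₂₂ - a * c₁₂,
    a₂ * b₁ - c₁ * c₂ + c * a₁₁ - a * c₁₁ - c * c₁₂ - b * c₂₂,
    a₁ * b₁ - b₁ * c₂ + b₂ * c₁ - c₁ ^ 2 + a * b₁₁ + 2 * c * b₁₂ - b * c₁₂]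

/-- `X` is an infinitesimal point symmetry of the system on the open set `U`: it is smooth on `U`
and `Pr⁽²⁾ X [Δ_μ] = 0` for all `μ` at every jet over `U` at which all `Δ_ν = 0`. -/
def IsInfinitesimalSymmetry (U : Set Pt) (X : Pt → Pt) : Prop :=
  ContDiffOn ℝ ∞ X U ∧
    ∀ j : Jet3, j.1.1.1 ∈ U → (∀ ν, system j.1 ν = 0) →
      ∀ μ, fderiv ℝ (fun q => system q μ) j.1 (prolongation X j) = 0

/-- The vector field with `ξ¹ = k₃ x + k₁ t + k₂`, `ξ² = k₆ x + k₄ t + k₅`,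
`φ₁ = 2 k₁ c + k₇ a`, `φ₂ = (2 k₄ - 2 k₃ + k₇) b + 2 k₆ c`,
`φ₃ = (k₇ + k₄ - k₃) c + k₆ a + k₁ b`. -/
def symmetryField (k₁ k₂ k₃ k₄ k₅ k₆ k₇ : ℝ) (z : Pt) : Pt :=
  let x := z.1 0
  let t := z.1 1
  let a := z.2 0
  let b := z.2 1
  let c := z.2 2
  (![k₃ * x + k₁ * t + k₂, k₆ * x + k₄ * t + k₅],
    ![2 * k₁ * c + k₇ * a,
      (2 * k₄ - 2 * k₃ + k₇) * b + 2 * k₆ * c,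
      (k₇ + k₄ - k₃) * c + k₆ * a + k₁ * b])

end WalkerSymmetry

namespace WalkerSymmetry

/-! At a point `z` the symmetry condition involves only `X z` and the derivatives `L`, `H` of `X` of
order one and two, and it is polynomial in the jet variables. Evaluating it on a few explicit
solution jets and taking differences isolates the determining equations.

At points with `a`, `b`, `c`, `a * b - c ^ 2` nonzero they say that `ξ` is independent of `u`
(`indep_du`), that `φ` is independent of `x` (`dep_dx`), and that the `u`-derivatives of `φ` are
tied to the `x`-derivatives of `ξ` (`firstOrder`). So `L` lies in a fixed linear space
`symmetryLinear`. Then every `H w` lies there too, and the symmetry of `H` forces `H = 0`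
(`eq_zero_of_forall_mem_symmetryLinear`). Generic points are dense and `H` is continuous, so `H = 0`
on all of `U`, and by connectedness `X` is affine. One generic point then fixes the value of `φ` in
terms of `L` (`value`), which leaves five linear parameters and two translations.

Conversely, for these fields each linearized equation is an explicit combination of the six
equations. -/

/-- The linearization of `system` at the jet `j`, applied to the jet space vector `v`. -/
def linearizedSystem (j v : Jet2) : Fin 6 → ℝ :=
  ![v.2 0 0 - v.2 2 1,
    v.2 1 1 + v.2 0 2,
    v.2 1 0 + v.2 2 2,
    v.1.2 0 0 * j.1.2 1 2 + j.1.2 0 0 * v.1.2 1 2 + v.1.2 1 0 * j.1.2 1 1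
      + j.1.2 1 0 * v.1.2 1 1 - v.1.2 1 0 * j.1.2 0 2 - j.1.2 1 0 * v.1.2 0 2
      - 2 * j.1.2 1 2 * v.1.2 1 2 + 2 * v.1.1.2 2 * j.2 1 0 + 2 * j.1.1.2 2 * v.2 1 0
      + v.1.1.2 1 * j.2 2 0 + j.1.1.2 1 * v.2 2 0 - v.1.1.2 0 * j.2 1 2 - j.1.1.2 0 * v.2 1 2,
    v.1.2 1 0 * j.1.2 0 1 + j.1.2 1 0 * v.1.2 0 1 - v.1.2 0 2 * j.1.2 1 2
      - j.1.2 0 2 * v.1.2 1 2 + v.1.1.2 2 * j.2 0 0 + j.1.1.2 2 * v.2 0 0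
      - v.1.1.2 0 * j.2 0 2 - j.1.1.2 0 * v.2 0 2 - v.1.1.2 2 * j.2 1 2 - j.1.1.2 2 * v.2 1 2
      - v.1.1.2 1 * j.2 2 2 - j.1.1.2 1 * v.2 2 2,
    v.1.2 0 0 * j.1.2 0 1 + j.1.2 0 0 * v.1.2 0 1 - v.1.2 0 1 * j.1.2 1 2
      - j.1.2 0 1 * v.1.2 1 2 + v.1.2 1 1 * j.1.2 0 2 + j.1.2 1 1 * v.1.2 0 2
      - 2 * j.1.2 0 2 * v.1.2 0 2 + v.1.1.2 0 * j.2 0 1 + j.1.1.2 0 * v.2 0 1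
      + 2 * v.1.1.2 2 * j.2 1 1 + 2 * j.1.1.2 2 * v.2 1 1 - v.1.1.2 1 * j.2 1 2
      - j.1.1.2 1 * v.2 1 2]

theorem differentiable_system (μ : Fin 6) : Differentiable ℝ (fun q => system q μ) := by
  fin_cases μ <;> simp [system] <;> fun_prop

theorem fderiv_system (j v : Jet2) (μ : Fin 6) :
    fderiv ℝ (fun q => system q μ) j v = linearizedSystem j v μ := by
  rw [← (differentiable_system μ j).lineDeriv_eq_fderiv]
  -- The first three equations are linear and the others are homogeneous quadratic, so the expansion
  -- in `s` is exact.
  have key : ∀ s : ℝ, system (j + s • v) μ = system j μ + s * linearizedSystem j v μ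
      + s ^ 2 * (if μ < 3 then 0 else system v μ) := by
    intro s
    fin_cases μ <;> simp [system, linearizedSystem] <;> ring
  have h : HasDerivAt (fun s : ℝ => system j μ + s * linearizedSystem j v μ
      + s ^ 2 * (if μ < 3 then 0 else system v μ)) (linearizedSystem j v μ) 0 := by
    have h1 := (hasDerivAt_id (0 : ℝ)).mul_const (linearizedSystem j v μ)
    have h2 := ((hasDerivAt_id (0 : ℝ)).pow 2).mul_const (if μ < 3 then 0 else system v μ)
    exact ((h1.const_add (system j μ)).add h2).congr_deriv (by simp)
  rw [lineDeriv]
  simp_rw [key]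
  exact h.deriv

/-! ### Prolongation in terms of the first and second derivatives of the field -/

/-- Coefficient of `∂_{u^α_i}` in the prolongation of a vector field with first derivative `L`, at
a jet with first order part `p`. -/
noncomputable def firstCoeff (L : Pt →L[ℝ] Pt) (p : Fin 2 → Fin 3 → ℝ) (i : Fin 2) (α : Fin 3) :
    ℝ :=
  (L (Pi.single i 1, p i)).2 α - ∑ l : Fin 2, (L (Pi.single i 1, p i)).1 l * p l α

/-- Coefficient of `∂_{u^α_{ik}}` in the prolongation of a vector field with first and second
derivatives `L` and `H`, at a jet with first and second order parts `p` and `q`. -/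
noncomputable def secondCoeff (L : Pt →L[ℝ] Pt) (H : Pt →L[ℝ] Pt →L[ℝ] Pt)
    (p : Fin 2 → Fin 3 → ℝ) (q : Fin 3 → Fin 3 → ℝ) (i k : Fin 2) (α : Fin 3) : ℝ :=
  (H (Pi.single i 1, p i) (Pi.single k 1, p k) + L (0, q (shift i k))).2 α
    - ∑ l : Fin 2, (H (Pi.single i 1, p i) (Pi.single k 1, p k) + L (0, q (shift i k))).1 l * p l α
    - ∑ l : Fin 2, (L (Pi.single k 1, p k)).1 l * q (shift i l) α
    - ∑ l : Fin 2, (L (Pi.single i 1, p i)).1 l * q (shift k l) α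

/-- The second prolongation in terms of the value `v` and the derivatives `L`, `H`. -/
noncomputable def prolongVec (v : Pt) (L : Pt →L[ℝ] Pt) (H : Pt →L[ℝ] Pt →L[ℝ] Pt)
    (p : Fin 2 → Fin 3 → ℝ) (q : Fin 3 → Fin 3 → ℝ) : Jet2 :=
  ((v, firstCoeff L p), ![secondCoeff L H p q 0 0, secondCoeff L H p q 0 1,
    secondCoeff L H p q 1 1])

theorem shift_comm (i k : Fin 2) : (shift i k : Fin 3) = shift k i := by
  simp [shift, add_comm]

/-- The coordinate `x^l` as a linear functional. -/
noncomputable def indepCoord (l : Fin 2) : Pt →L[ℝ] ℝ :=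
  (ContinuousLinearMap.proj l).comp (.fst ℝ (Fin 2 → ℝ) (Fin 3 → ℝ))

/-- The coordinate `u^α` as a linear functional. -/
noncomputable def depCoord (α : Fin 3) : Pt →L[ℝ] ℝ :=
  (ContinuousLinearMap.proj α).comp (.snd ℝ (Fin 2 → ℝ) (Fin 3 → ℝ))

@[simp] theorem indepCoord_apply (l : Fin 2) (z : Pt) : indepCoord l z = z.1 l := rfl

@[simp] theorem depCoord_apply (α : Fin 3) (z : Pt) : depCoord α z = z.2 α := rfl

section

variable {E : Type*} [NormedAddCommGroup E] [NormedSpace ℝ E] {f : E → Pt} {f' : E →L[ℝ] Pt} {e : E}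

theorem hasFDerivAt_indepCoord (h : HasFDerivAt f f' e) (l : Fin 2) :
    HasFDerivAt (fun x => (f x).1 l) ((indepCoord l).comp f') e :=
  (indepCoord l).hasFDerivAt.comp e h

theorem hasFDerivAt_depCoord (h : HasFDerivAt f f' e) (α : Fin 3) :
    HasFDerivAt (fun x => (f x).2 α) ((depCoord α).comp f') e :=
  (depCoord α).hasFDerivAt.comp e h

end

/-- The coordinate `u^α_l` as a linear functional on first order jets. -/
noncomputable def jetCoord₁ (l : Fin 2) (α : Fin 3) : Jet1 →L[ℝ] ℝ :=
  (ContinuousLinearMap.proj α).comp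
    ((ContinuousLinearMap.proj (φ := fun _ : Fin 2 => Fin 3 → ℝ) l).comp (.snd ℝ Pt _))

@[simp] theorem jetCoord₁_apply (l : Fin 2) (α : Fin 3) (j : Jet1) : jetCoord₁ l α j = j.2 l α :=
  rfl

/-- A second order derivative coordinate as a linear functional on second order jets. -/
noncomputable def jetCoord₂ (m α : Fin 3) : Jet2 →L[ℝ] ℝ :=
  (ContinuousLinearMap.proj α).comp
    ((ContinuousLinearMap.proj (φ := fun _ : Fin 3 => Fin 3 → ℝ) m).comp (.snd ℝ Jet1 _))

@[simp] theorem jetCoord₂_apply (m α : Fin 3) (j : Jet2) : jetCoord₂ m α j = j.2 m α := rfl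

theorem fderiv_charQ {X : Pt → Pt} {L : Pt →L[ℝ] Pt} {j : Jet1}
    (h : HasFDerivAt X L j.1) (α : Fin 3) (w : Jet1) :
    fderiv ℝ (charQ X α) j w =
      (L w.1).2 α - ∑ l : Fin 2, ((L w.1).1 l * j.2 l α + (X j.1).1 l * w.2 l α) := by
  have hX : HasFDerivAt (fun q : Jet1 => X q.1) (L.comp (.fst ℝ _ _)) j :=
    h.comp j hasFDerivAt_fst
  have hQ : HasFDerivAt (charQ X α) _ j :=
    (hasFDerivAt_depCoord hX α).sub (HasFDerivAt.fun_sum (u := Finset.univ) fun l _ =>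
      (hasFDerivAt_indepCoord hX l).mul (jetCoord₁ l α).hasFDerivAt)
  rw [hQ.fderiv]
  simp
  ring

theorem totalD1_charQ {X : Pt → Pt} {j : Jet2} (h : DifferentiableAt ℝ X j.1.1) (i : Fin 2)
    (α : Fin 3) :
    totalD1 i (charQ X α) j = (fderiv ℝ X j.1.1 (totalVec0 i j.1)).2 α
      - ∑ l : Fin 2, (fderiv ℝ X j.1.1 (totalVec0 i j.1)).1 l * j.1.2 l α
      - ∑ l : Fin 2, (X j.1.1).1 l * j.2 (shift l i) α := by
  rw [totalD1, fderiv_charQ h.hasFDerivAt]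
  simp [totalVec1]
  ring

theorem prolong1_eq {X : Pt → Pt} {j : Jet2} (h : DifferentiableAt ℝ X j.1.1) (i : Fin 2)
    (α : Fin 3) : prolong1 X i α j = firstCoeff (fderiv ℝ X j.1.1) j.1.2 i α := by
  rw [prolong1, totalD1_charQ h, firstCoeff]
  simp [totalVec0, shift_comm i]

/-- The total derivative vector field on first order jets is affine in the jet. -/
theorem hasFDerivAt_totalVec0 (k : Fin 2) (j : Jet2) :
    HasFDerivAt (fun q : Jet2 => totalVec0 k q.1)
      ((ContinuousLinearMap.inr ℝ (Fin 2 → ℝ) (Fin 3 → ℝ)).comp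
        ((ContinuousLinearMap.proj (φ := fun _ : Fin 2 => Fin 3 → ℝ) k).comp
          ((ContinuousLinearMap.snd ℝ Pt _).comp (.fst ℝ Jet1 (Fin 3 → Fin 3 → ℝ))))) j := by
  set A := (ContinuousLinearMap.inr ℝ (Fin 2 → ℝ) (Fin 3 → ℝ)).comp
        ((ContinuousLinearMap.proj (φ := fun _ : Fin 2 => Fin 3 → ℝ) k).comp
          ((ContinuousLinearMap.snd ℝ Pt _).comp (.fst ℝ Jet1 (Fin 3 → Fin 3 → ℝ)))) with hA
  have : (fun q : Jet2 => totalVec0 k q.1) = fun q => A q + (Pi.single k 1, 0) := by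
    ext q <;> simp [totalVec0, hA]
  rw [this]
  exact A.hasFDerivAt.add_const _

/-- Differentiating the term `-ξ^l u^α_{k,l}` of `D_k Q_α` produces the third order coordinates, and
the correction `ξ^l u^α_{ik,l}` cancels them. -/
theorem prolong2_eq {X : Pt → Pt} {j : Jet3}
    (h : ∀ᶠ y in nhds j.1.1.1, DifferentiableAt ℝ X y)
    {H : Pt →L[ℝ] Pt →L[ℝ] Pt} (hH : HasFDerivAt (fderiv ℝ X) H j.1.1.1) (i k : Fin 2)
    (α : Fin 3) :
    prolong2 X i k α j = secondCoeff (fderiv ℝ X j.1.1.1) H j.1.1.2 j.1.2 i k α := by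
  have hcont : Continuous fun q : Jet2 => q.1.1 := by fun_prop
  have hev : totalD1 k (charQ X α) =ᶠ[nhds j.1] fun q =>
      (fderiv ℝ X q.1.1 (totalVec0 k q.1)).2 α
      - ∑ l : Fin 2, (fderiv ℝ X q.1.1 (totalVec0 k q.1)).1 l * q.1.2 l α
      - ∑ l : Fin 2, (X q.1.1).1 l * q.2 (shift l k) α :=
    (hcont.continuousAt.eventually h).mono fun q hq => totalD1_charQ hq k α
  have hbase : HasFDerivAt (fun q : Jet2 => q.1.1) ((ContinuousLinearMap.fst ℝ Pt _).comp
      (.fst ℝ Jet1 (Fin 3 → Fin 3 → ℝ))) j.1 :=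
    hasFDerivAt_fst.comp j.1 hasFDerivAt_fst
  have hX : HasFDerivAt (fun q : Jet2 => X q.1.1) _ j.1 :=
    h.self_of_nhds.hasFDerivAt.comp j.1 hbase
  have hD : HasFDerivAt (fun q : Jet2 => fderiv ℝ X q.1.1) _ j.1 := hH.comp j.1 hbase
  have hT := hD.clm_apply (hasFDerivAt_totalVec0 k j.1)
  have hF := ((hasFDerivAt_depCoord hT α).sub (HasFDerivAt.fun_sum (u := Finset.univ) fun l _ =>
      (hasFDerivAt_indepCoord hT l).mul ((jetCoord₁ l α).hasFDerivAt.comp j.1 hasFDerivAt_fst))).sub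
      (HasFDerivAt.fun_sum (u := Finset.univ) fun l _ =>
      (hasFDerivAt_indepCoord hX l).mul (jetCoord₂ (shift l k) α).hasFDerivAt)
  have hd : fderiv ℝ (totalD1 k (charQ X α)) j.1 = _ := hev.fderiv_eq.trans hF.fderiv
  have hs : ∀ l, (shift (shift k l) i : Fin 4) = shift (shift i k) l := fun l => by
    simp [shift]; omega
  rw [prolong2, totalD2, hd, secondCoeff]
  simp [totalVec0, totalVec1, totalVec2, hs, shift_comm]
  ring

/-- The condition that the prolongation with data `v`, `L`, `H` annihilates the system on all jets
over `z`. -/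
def PointwiseSymmetry (z v : Pt) (L : Pt →L[ℝ] Pt) (H : Pt →L[ℝ] Pt →L[ℝ] Pt) : Prop :=
  ∀ p q, (∀ ν, system ((z, p), q) ν = 0) →
    ∀ μ, linearizedSystem ((z, p), q) (prolongVec v L H p q) μ = 0

theorem prolongation_eq {X : Pt → Pt} {j : Jet3}
    (h : ∀ᶠ y in nhds j.1.1.1, DifferentiableAt ℝ X y)
    {H : Pt →L[ℝ] Pt →L[ℝ] Pt} (hH : HasFDerivAt (fderiv ℝ X) H j.1.1.1) :
    prolongation X j =
      prolongVec (X j.1.1.1) (fderiv ℝ X j.1.1.1) H j.1.1.2 j.1.2 := by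
  simp only [prolongation, prolongVec, prolong2_eq h hH]
  congr 2
  ext i α
  exact prolong1_eq (j := j.1) h.self_of_nhds i α

theorem isInfinitesimalSymmetry_iff {U : Set Pt} (hU : IsOpen U) {X : Pt → Pt} :
    IsInfinitesimalSymmetry U X ↔ ContDiffOn ℝ ∞ X U ∧
      ∀ z ∈ U, PointwiseSymmetry z (X z) (fderiv ℝ X z) (fderiv ℝ (fderiv ℝ X) z) := by
  refine and_congr_right fun hX => ?_
  have hat : ∀ z ∈ U, ContDiffAt ℝ ∞ X z := fun z hz => hX.contDiffAt (hU.mem_nhds hz)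
  have hev : ∀ z ∈ U, ∀ᶠ y in nhds z, DifferentiableAt ℝ X y := fun z hz =>
    (hU.eventually_mem hz).mono fun y hy => (hat y hy).differentiableAt (by simp)
  have hH : ∀ z ∈ U, HasFDerivAt (fderiv ℝ X) (fderiv ℝ (fderiv ℝ X) z) z := fun z hz =>
    (((hat z hz).fderiv_right (m := 1) (by norm_cast)).differentiableAt
      (by simp)).hasFDerivAt
  constructor
  · intro h z hz p q hs μ
    -- The third order coordinates are irrelevant and are set to zero.
    have := h (((z, p), q), 0) hz hs μ
    rwa [fderiv_system, prolongation_eq (hev z hz) (hH z hz)] at this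
  · intro h j hj hs μ
    rw [fderiv_system, prolongation_eq (hev _ hj) (hH _ hj)]
    exact h _ hj _ _ hs μ

/-! ### Determining equations at a single point -/

/-- The coordinate vector field of `x^i`. -/
def dx (i : Fin 2) : Pt := (Pi.single i 1, 0)

/-- The coordinate vector field of `u^α`. -/
def du (α : Fin 3) : Pt := (0, Pi.single α 1)

theorem map_pt {F : Type*} [NormedAddCommGroup F] [NormedSpace ℝ F] (L : Pt →L[ℝ] F)
    (r : Fin 2 → ℝ) (s : Fin 3 → ℝ) :
    L (r, s) = r 0 • L (dx 0) + r 1 • L (dx 1) + s 0 • L (du 0) + s 1 • L (du 1)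
      + s 2 • L (du 2) := by
  have : ((r, s) : Pt) = r 0 • dx 0 + r 1 • dx 1 + s 0 • du 0 + s 1 • du 1 + s 2 • du 2 := by
    ext i <;> fin_cases i <;> simp [dx, du]
  rw [this]
  simp

theorem shift_zero_zero : (shift 0 0 : Fin 3) = 0 := rfl
theorem shift_zero_one : (shift 0 1 : Fin 3) = 1 := rfl
theorem shift_one_zero : (shift 1 0 : Fin 3) = 1 := rfl
theorem shift_one_one : (shift 1 1 : Fin 3) = 2 := rfl

/-- The linear algebra of the determining equations at vanishing first derivatives. -/
theorem kernel_relations {a b c Xx Xt Tx Tt Aa Ab Ac Ba Bb Bc Ca Cb Cc A B C : ℝ}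
    (ha : a ≠ 0) (hb : b ≠ 0) (hc : c ≠ 0) (hd : a * b - c ^ 2 ≠ 0)
    (h : ∀ a₁₁ a₁₂ a₂₂ b₁₁ c₁₁ c₁₂ : ℝ, 2 * c * a₁₂ + b * a₂₂ - a * c₁₂ = 0 →
      c * a₁₁ - a * c₁₁ - c * c₁₂ + b * a₁₂ = 0 → a * b₁₁ - 2 * c * c₁₁ - b * c₁₂ = 0 →
      (Aa - 2 * Xx - Bb + 2 * Tt) * a₁₁ + Ab * b₁₁ + (Ac - 2 * Xt) * c₁₁ + (Bc - 2 * Tx) * a₁₂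
        - Ba * a₂₂ = 0 ∧
      a₁₂ * Ba + c₁₁ * (-Bb - Xx + Tt + Cc) + c₁₂ * (Bc - 2 * Tx) + a₁₁ * (Ca - Tx)
        + b₁₁ * (Cb - Xt) = 0 ∧
      a₁₂ * (Aa - Xx + Tt - Cc) - Ab * c₁₁ + c₁₂ * (Ac - 2 * Xt) + a₂₂ * (Ca - Tx)
        + a₁₁ * (Cb - Xt) = 0 ∧
      2 * a₁₂ * C + a₂₂ * B - c₁₂ * A
        + 2 * c * (Aa * a₁₂ - Ab * c₁₁ + Ac * c₁₂ - Xx * a₁₂ - Tx * a₂₂ - Xt * a₁₁ - Tt * a₁₂)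
        + b * (Aa * a₂₂ + Ab * a₁₁ - Ac * a₁₂ - 2 * Xt * a₁₂ - 2 * Tt * a₂₂)
        - a * (Ca * a₁₂ - Cb * c₁₁ + Cc * c₁₂ - Xx * c₁₂ + Tx * a₁₂ - Xt * c₁₁ - Tt * c₁₂) = 0) :
    (Bb = Aa - 2 * Xx + 2 * Tt ∧ Cc = Aa - Xx + Tt ∧ Ab = 0 ∧ Ba = 0 ∧ Ac = 2 * Xt ∧
      Bc = 2 * Tx ∧ Ca = Tx ∧ Cb = Xt) ∧
    a * (C - Cc * c - Tx * a - Xt * b) = c * (A - Aa * a - 2 * Xt * c) := by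
  -- The three jets used here and below form a basis of the three-dimensional solution space of the
  -- constraints.
  obtain ⟨h₁, h₂, h₃, h₄⟩ :=
    h (a ^ 2) 0 0 (2 * c ^ 2) (a * c) 0 (by ring) (by ring) (by ring)
  obtain ⟨k₁, k₂, k₃, k₄⟩ :=
    h (b ^ 2) (-(b * c)) (2 * c ^ 2) 0 0 0 (by ring) (by ring) (by ring)
  obtain ⟨l₁, l₂, l₃, l₄⟩ := h 0 0 (a ^ 3) (a * b ^ 2 - 2 * b * c ^ 2) (-(a * b * c)) (a ^ 2 * b)
    (by ring) (by ring) (by ring)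
  clear h
  -- Each unknown becomes its expected value plus a defect, and the defects are shown to vanish one
  -- at a time.
  obtain ⟨w, rfl⟩ : ∃ w, Bb = Aa - 2 * Xx + 2 * Tt + w := ⟨Bb - (Aa - 2 * Xx + 2 * Tt), by ring⟩
  obtain ⟨w', rfl⟩ : ∃ w, Cc = Aa - Xx + Tt + w := ⟨Cc - (Aa - Xx + Tt), by ring⟩
  obtain ⟨wA, rfl⟩ : ∃ w, Ac = 2 * Xt + w := ⟨Ac - 2 * Xt, by ring⟩
  obtain ⟨wB, rfl⟩ : ∃ w, Bc = 2 * Tx + w := ⟨Bc - 2 * Tx, by ring⟩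
  obtain ⟨wa, rfl⟩ : ∃ w, Ca = Tx + w := ⟨Ca - Tx, by ring⟩
  obtain ⟨wb, rfl⟩ : ∃ w, Cb = Xt + w := ⟨Cb - Xt, by ring⟩
  have hAb : Ab = 0 := by
    have : a ^ 2 * ((a * b - c ^ 2) * Ab) = 0 := by linear_combination a * h₄ - c * a * h₃
    simpa [ha, hd] using this
  subst hAb
  obtain rfl : wb = 0 := by
    have : a ^ 2 * wb = 0 := by linear_combination h₃
    simpa [ha] using this
  have hBa : Ba = 0 := by
    have : a ^ 3 * b * ((a * b - c ^ 2) * Ba) = 0 := by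
      linear_combination (-(b ^ 2 * a)) * l₁ - b * c * b * l₃ + a ^ 3 * c * k₂
    simpa [ha, hb, hd] using this
  subst hBa
  obtain rfl : wa = 0 := by
    have : b ^ 2 * wa = 0 := by linear_combination k₂
    simpa [hb] using this
  obtain rfl : wA = 0 := by
    have : a ^ 2 * b * wA = 0 := by linear_combination l₃
    simpa [ha, hb] using this
  obtain rfl : w = 0 := by
    have : a ^ 2 * w = 0 := by linear_combination -h₁
    simpa [ha] using this
  obtain rfl : wB = 0 := by
    have : b * c * wB = 0 := by linear_combination -k₁
    simpa [hb, hc] using this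
  obtain rfl : w' = 0 := by
    have : b * c * w' = 0 := by linear_combination k₃
    simpa [hb, hc] using this
  refine ⟨by simp, ?_⟩
  -- Eliminating `B` between `l₄` and `k₄` leaves the relation between `A` and `C`.
  have h₀ : 2 * a ^ 2 * b * c ≠ 0 := by positivity
  refine mul_left_cancel₀ h₀ ?_
  linear_combination 2 * c ^ 2 * l₄ - a ^ 3 * k₄

variable {z v : Pt} {L : Pt →L[ℝ] Pt} {H : Pt →L[ℝ] Pt →L[ℝ] Pt}

-- In the constant-coefficient equation `a₁₁ - b₂₂ = 0`, terms bilinear in first and second order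
-- jet coordinates arise only from the `u`-derivatives of `ξ`. Each first order direction is paired
-- with one solution of the second order constraints.
set_option maxHeartbeats 1000000 in
theorem PointwiseSymmetry.indep_du (h : PointwiseSymmetry z v L H) (ha : z.2 0 ≠ 0)
    (hb : z.2 1 ≠ 0) (β : Fin 3) (l : Fin 2) : (L (du β)).1 l = 0 := by
  generalize ha' : z.2 0 = a at *
  generalize hb' : z.2 1 = b at *
  generalize hc' : z.2 2 = c at *
  have h0 := h ![![0, 0, 0], ![0, 0, 0]] ![![0, 0, 0], ![0, 0, 0], ![0, 0, 0]]
    (by intro ν; fin_cases ν <;> simp [system]) 0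
  have k0 := h ![![0, 0, 0], ![0, 0, 0]]
    ![![a ^ 2, 2 * c ^ 2, a * c], ![0, -(a * c), 0], ![0, a ^ 2, 0]]
    (by intro ν; fin_cases ν <;> simp [system, ha', hb', hc'] <;> ring) 0
  have hax := h ![![1, 0, 0], ![0, 0, 0]] ![![0, 0, 0], ![0, 0, 0], ![0, 0, 0]]
    (by intro ν; fin_cases ν <;> simp [system]) 0
  have kax := h ![![1, 0, 0], ![0, 0, 0]]
    ![![a ^ 2, 2 * c ^ 2, a * c], ![0, -(a * c), 0], ![0, a ^ 2, 0]]
    (by intro ν; fin_cases ν <;> simp [system, ha', hb', hc'] <;> ring) 0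
  have hat := h ![![0, 0, 0], ![1, 0, 0]] ![![0, 0, 0], ![0, 0, 0], ![0, 0, 0]]
    (by intro ν; fin_cases ν <;> simp [system]) 0
  have kat := h ![![0, 0, 0], ![1, 0, 0]]
    ![![a ^ 2, 2 * c ^ 2, a * c], ![0, -(a * c), 0], ![0, a ^ 2, 0]]
    (by intro ν; fin_cases ν <;> simp [system, ha', hb', hc'] <;> ring) 0
  have hbx := h ![![0, 1, 0], ![0, 0, 0]] ![![0, 0, 0], ![0, 0, 0], ![0, 0, 0]]
    (by intro ν; fin_cases ν <;> simp [system]) 0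
  have kbx := h ![![0, 1, 0], ![0, 0, 0]]
    ![![a ^ 2, 2 * c ^ 2, a * c], ![0, -(a * c), 0], ![0, a ^ 2, 0]]
    (by intro ν; fin_cases ν <;> simp [system, ha', hb', hc'] <;> ring) 0
  have hbt := h ![![0, 0, 0], ![0, 1, 0]] ![![0, 0, 0], ![0, 0, 0], ![0, 0, 0]]
    (by intro ν; fin_cases ν <;> simp [system]) 0
  have kbt := h ![![0, 0, 0], ![0, 1, 0]]
    ![![a ^ 2, 2 * c ^ 2, a * c], ![0, -(a * c), 0], ![0, a ^ 2, 0]]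
    (by intro ν; fin_cases ν <;> simp [system, ha', hb', hc'] <;> ring) 0
  -- Here `b₁₁ = a` balances `c₁ ^ 2` in the last equation; for `hct`, `a₂₂ = b` balances `c₂ ^ 2`
  -- in the fourth.
  have hcx := h ![![0, 0, a], ![0, 0, 0]] ![![0, a, 0], ![0, 0, 0], ![0, 0, 0]]
    (by intro ν; fin_cases ν <;> simp [system, ha', hb', hc']; ring) 0
  have kcx := h ![![0, 0, a], ![0, 0, 0]]
    ![![a ^ 2, 2 * c ^ 2 + a, a * c], ![0, -(a * c), 0], ![0, a ^ 2, 0]]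
    (by intro ν; fin_cases ν <;> simp [system, ha', hb', hc'] <;> ring) 0
  have hct := h ![![0, 0, 0], ![0, 0, b]] ![![0, 0, 0], ![0, 0, 0], ![b, 0, 0]]
    (by intro ν; fin_cases ν <;> simp [system, ha', hb', hc']; ring) 0
  have kct := h ![![0, 0, 0], ![0, 0, b]]
    ![![a ^ 2, 2 * c ^ 2, a * c], ![0, -(a * c), 0], ![b, a ^ 2, 0]]
    (by intro ν; fin_cases ν <;> simp [system, ha', hb', hc'] <;> ring) 0
  simp [linearizedSystem, prolongVec, secondCoeff, map_pt, shift_zero_zero, shift_zero_one,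
    shift_one_zero, shift_one_one, ha', hb', hc'] at h0 k0 hax kax hat kat hbx kbx hbt kbt hcx kcx hct kct
  -- The mixed second difference of the four jets keeps only the bilinear terms.
  have hXc : (L (du 2)).1 0 = 0 := by
    have : a ^ 3 * (L (du 2)).1 0 = 0 := by linear_combination -(kcx - hcx - k0 + h0) / 2
    simpa [ha] using this
  have hTc : (L (du 2)).1 1 = 0 := by
    have : b * a ^ 2 * (L (du 2)).1 1 = 0 := by linear_combination (kct - hct - k0 + h0) / 2 + a * b * c * hXc
    simpa [ha, hb] using this
  simp only [hXc, hTc] at kbx kbt kax kat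
  have hXb : (L (du 1)).1 0 = 0 := by
    have : a ^ 2 * (L (du 1)).1 0 = 0 := by linear_combination -(kbx - hbx - k0 + h0)
    simpa [ha] using this
  have hTb : (L (du 1)).1 1 = 0 := by
    have : 3 * a ^ 2 * (L (du 1)).1 1 = 0 := by linear_combination kbt - hbt - k0 + h0 + 2 * a * c * hXb
    simpa [ha] using this
  simp only [hXb, hTb] at kax kat
  have hXa : (L (du 0)).1 0 = 0 := by
    have : 3 * a ^ 2 * (L (du 0)).1 0 = 0 := by linear_combination -(kax - hax - k0 + h0)
    simpa [ha] using this
  have hTa : (L (du 0)).1 1 = 0 := by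
    have : a ^ 2 * (L (du 0)).1 1 = 0 := by linear_combination kat - hat - k0 + h0 + 2 * a * c * hXa
    simpa [ha] using this
  fin_cases β <;> fin_cases l <;> assumption

/-- The linear parts of the vector fields `symmetryField k₁ ... k₇`. -/
def symmetryLinear : Submodule ℝ (Pt →L[ℝ] Pt) where
  carrier := {L | (∀ β l, (L (du β)).1 l = 0) ∧ (∀ i α, (L (dx i)).2 α = 0) ∧
    (L (du 1)).2 1 = (L (du 0)).2 0 - 2 * (L (dx 0)).1 0 + 2 * (L (dx 1)).1 1 ∧
    (L (du 2)).2 2 = (L (du 0)).2 0 - (L (dx 0)).1 0 + (L (dx 1)).1 1 ∧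
    (L (du 1)).2 0 = 0 ∧ (L (du 0)).2 1 = 0 ∧
    (L (du 2)).2 0 = 2 * (L (dx 1)).1 0 ∧ (L (du 2)).2 1 = 2 * (L (dx 0)).1 1 ∧
    (L (du 0)).2 2 = (L (dx 0)).1 1 ∧ (L (du 1)).2 2 = (L (dx 1)).1 0}
  add_mem' := by
    rintro L M ⟨h₁, h₂, h₃, h₄, h₅, h₆, h₇, h₈, h₉, h₁₀⟩ ⟨k₁, k₂, k₃, k₄, k₅, k₆, k₇, k₈, k₉, k₁₀⟩
    refine ⟨fun β l => by simp [h₁, k₁], fun i α => by simp [h₂, k₂], ?_, ?_, ?_, ?_, ?_, ?_, ?_, ?_⟩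
      <;> simp only [add_apply, Prod.fst_add, Prod.snd_add, Pi.add_apply]
      <;> linarith
  zero_mem' := by simp
  smul_mem' := by
    rintro r L ⟨h₁, h₂, h₃, h₄, h₅, h₆, h₇, h₈, h₉, h₁₀⟩
    refine ⟨fun β l => by simp [h₁], fun i α => by simp [h₂], ?_, ?_, ?_, ?_, ?_, ?_, ?_, ?_⟩
      <;> simp only [smul_apply, Prod.smul_fst, Prod.smul_snd, Pi.smul_apply,
        smul_eq_mul, *]
      <;> ring

theorem clm_ext {F : Type*} [NormedAddCommGroup F] [NormedSpace ℝ F] {L M : Pt →L[ℝ] F}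
    (hx : ∀ i, L (dx i) = M (dx i)) (hu : ∀ α, L (du α) = M (du α)) : L = M := by
  refine ContinuousLinearMap.ext fun w => ?_
  obtain ⟨r, s⟩ := w
  simp only [map_pt, hx, hu]

/-- The first prolongation of the space `symmetryLinear` vanishes. -/
theorem eq_zero_of_forall_mem_symmetryLinear {H : Pt →L[ℝ] Pt →L[ℝ] Pt}
    (hs : ∀ u w, H u w = H w u) (h : ∀ w, H w ∈ symmetryLinear) : H = 0 := by
  -- Membership of `H (dx i)` kills the `ξ` part, and membership of `H (du β)` with symmetry kills
  -- the `φ` part.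
  have hxu : ∀ i β, H (dx i) (du β) = 0 := fun i β => by
    ext l
    · exact (h (dx i)).1 β l
    · rw [hs]; exact (h (du β)).2.1 i l
  have hux : ∀ i β, H (du β) (dx i) = 0 := fun i β => by rw [hs, hxu]
  -- With mixed terms gone, each `H (dx i)` is scalar on the `x`-directions and each `H (du β)` is
  -- scalar on the `u`-directions. A symmetric form with `H u w = λ(u) w` vanishes in dimension at
  -- least two.
  obtain ⟨-, hx₀, -, p₁, -, -, -, -, p₂, p₃⟩ := h (dx 0)
  obtain ⟨-, hx₁, -, q₁, -, -, -, -, q₂, q₃⟩ := h (dx 1)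
  obtain ⟨r₀, -, r₁, r₂, r₃, r₄, r₅, r₆, r₇, r₈⟩ := h (du 0)
  obtain ⟨s₀, -, s₁, s₂, s₃, s₄, s₅, s₆, s₇, s₈⟩ := h (du 1)
  obtain ⟨t₀, -, t₁, t₂, t₃, t₄, t₅, t₆, t₇, t₈⟩ := h (du 2)
  have e₁ := hs (dx 1) (dx 0)
  have e₂ := hs (du 1) (du 0)
  have e₃ := hs (du 2) (du 0)
  have e₄ := hs (du 2) (du 1)
  simp only [hxu, hux, Prod.fst_zero, Prod.snd_zero, Pi.zero_apply, mul_zero, sub_zero, add_zero,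
    zero_sub, e₁] at p₁ p₂ p₃ q₁ q₂ q₃ r₁ r₂ r₃ r₄ r₅ r₆ r₇ r₈
  simp only [hux, Prod.fst_zero, Pi.zero_apply, mul_zero, sub_zero, add_zero, e₂, e₃, e₄] at s₁ s₂ s₃ s₄ s₅ s₆ s₇ s₈ t₁ t₂ t₃ t₄ t₅ t₆ t₇ t₈
  refine clm_ext (fun i => clm_ext (fun k => ?_) fun β => ?_)
    fun α => clm_ext (fun k => ?_) fun β => ?_
  · ext l
    · fin_cases i <;> fin_cases k <;> fin_cases l <;> simp [e₁] <;> linarith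
    · fin_cases i <;> fin_cases k <;> simp [e₁, hx₀, hx₁]
  · simp [hxu]
  · simp [hux]
  · ext l
    · fin_cases α <;> fin_cases β <;> simp [e₂, e₃, e₄, r₀, s₀, t₀]
    · fin_cases α <;> fin_cases β <;> fin_cases l <;> simp [e₂, e₃, e₄] <;> linarith

/-- At jets with vanishing first derivatives the condition is affine in the second derivatives;
subtracting its value at the zero jet leaves the linear part, treated by `kernel_relations`. -/
theorem PointwiseSymmetry.firstOrder (h : PointwiseSymmetry z v L H) (ha : z.2 0 ≠ 0)
    (hb : z.2 1 ≠ 0) (hc : z.2 2 ≠ 0) (hd : z.2 0 * z.2 1 - z.2 2 ^ 2 ≠ 0) :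
    ((L (du 1)).2 1 = (L (du 0)).2 0 - 2 * (L (dx 0)).1 0 + 2 * (L (dx 1)).1 1 ∧
    (L (du 2)).2 2 = (L (du 0)).2 0 - (L (dx 0)).1 0 + (L (dx 1)).1 1 ∧
    (L (du 1)).2 0 = 0 ∧ (L (du 0)).2 1 = 0 ∧
    (L (du 2)).2 0 = 2 * (L (dx 1)).1 0 ∧ (L (du 2)).2 1 = 2 * (L (dx 0)).1 1 ∧
    (L (du 0)).2 2 = (L (dx 0)).1 1 ∧ (L (du 1)).2 2 = (L (dx 1)).1 0) ∧
    z.2 0 * (v.2 2 - (L (du 2)).2 2 * z.2 2 - (L (dx 0)).1 1 * z.2 0 - (L (dx 1)).1 0 * z.2 1) =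
      z.2 2 * (v.2 0 - (L (du 0)).2 0 * z.2 0 - 2 * (L (dx 1)).1 0 * z.2 2) := by
  refine kernel_relations (B := v.2 1) ha hb hc hd
    fun a₁₁ a₁₂ a₂₂ b₁₁ c₁₁ c₁₂ h₁ h₂ h₃ => ?_
  have k₀ := h ![![0, 0, 0], ![0, 0, 0]] ![![0, 0, 0], ![0, 0, 0], ![0, 0, 0]]
    (by intro ν; fin_cases ν <;> simp [system])
  have k := h ![![0, 0, 0], ![0, 0, 0]]
    ![![a₁₁, b₁₁, c₁₁], ![a₁₂, -c₁₁, c₁₂], ![a₂₂, a₁₁, -a₁₂]] (by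
      intro ν
      fin_cases ν <;> simp [system] <;> linarith)
  have k₁ := k 0
  have k₂ := k 1
  have k₃ := k 2
  have k₄ := k 3
  have l₁ := k₀ 0
  have l₂ := k₀ 1
  have l₃ := k₀ 2
  have l₄ := k₀ 3
  clear k k₀
  simp [linearizedSystem, prolongVec, firstCoeff, secondCoeff, map_pt, shift_zero_zero,
    shift_zero_one, shift_one_zero, shift_one_one] at k₁ k₂ k₃ k₄ l₁ l₂ l₃ l₄
  refine ⟨?_, ?_, ?_, ?_⟩
  · linear_combination k₁ - l₁
  · linear_combination k₂ - l₂
  · linear_combination k₃ - l₃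
  · linear_combination k₄ - l₄

-- With no second derivatives and one first derivative of `a` or `b` equal to `±1`, half the
-- difference of the two conditions is their odd part. By `hL` and `hH` no cubic terms occur, so
-- this is the part linear in that derivative: it involves only `φ_x`, `φ_xu` and `ξ_xx`.
set_option maxHeartbeats 1000000 in
theorem PointwiseSymmetry.dep_dx (h : PointwiseSymmetry z v L H) (ha : z.2 0 ≠ 0)
    (hb : z.2 1 ≠ 0) (hc : z.2 2 ≠ 0) (hs : ∀ u w, H u w = H w u)
    (hL : ∀ β l, (L (du β)).1 l = 0) (hH : ∀ w β l, (H w (du β)).1 l = 0) (i : Fin 2)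
    (α : Fin 3) : (L (dx i)).2 α = 0 := by
  have hux : ∀ i β, H (du β) (dx i) = H (dx i) (du β) := fun i β => hs _ _
  generalize ha' : z.2 0 = a at *
  generalize hb' : z.2 1 = b at *
  generalize hc' : z.2 2 = c at *
  have ja := h ![![1, 0, 0], ![0, 0, 0]] ![![0, 0, 0], ![0, 0, 0], ![0, 0, 0]]
    (by intro ν; fin_cases ν <;> simp [system])
  have ja' := h ![![-1, 0, 0], ![0, 0, 0]] ![![0, 0, 0], ![0, 0, 0], ![0, 0, 0]]
    (by intro ν; fin_cases ν <;> simp [system])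
  have jb := h ![![0, 1, 0], ![0, 0, 0]] ![![0, 0, 0], ![0, 0, 0], ![0, 0, 0]]
    (by intro ν; fin_cases ν <;> simp [system])
  have jb' := h ![![0, -1, 0], ![0, 0, 0]] ![![0, 0, 0], ![0, 0, 0], ![0, 0, 0]]
    (by intro ν; fin_cases ν <;> simp [system])
  have ka := h ![![0, 0, 0], ![1, 0, 0]] ![![0, 0, 0], ![0, 0, 0], ![0, 0, 0]]
    (by intro ν; fin_cases ν <;> simp [system])
  have ka' := h ![![0, 0, 0], ![-1, 0, 0]] ![![0, 0, 0], ![0, 0, 0], ![0, 0, 0]]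
    (by intro ν; fin_cases ν <;> simp [system])
  have kb := h ![![0, 0, 0], ![0, 1, 0]] ![![0, 0, 0], ![0, 0, 0], ![0, 0, 0]]
    (by intro ν; fin_cases ν <;> simp [system])
  have kb' := h ![![0, 0, 0], ![0, -1, 0]] ![![0, 0, 0], ![0, 0, 0], ![0, 0, 0]]
    (by intro ν; fin_cases ν <;> simp [system])
  simp [Fin.forall_fin_succ, linearizedSystem, prolongVec, firstCoeff, secondCoeff, map_pt,
    shift_zero_zero, shift_zero_one, shift_one_zero, shift_one_one, ha', hb', hc', hL, hH, hux] at ja ja' jb jb' ka ka' kb kb'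
  obtain ⟨ja₁, ja₂, ja₃, ja₄, ja₅, ja₆⟩ := ja
  obtain ⟨ja'₁, ja'₂, ja'₃, ja'₄, ja'₅, ja'₆⟩ := ja'
  obtain ⟨jb₁, jb₂, jb₃, jb₄, jb₅, jb₆⟩ := jb
  obtain ⟨jb'₁, jb'₂, jb'₃, jb'₄, jb'₅, jb'₆⟩ := jb'
  obtain ⟨ka₁, ka₂, ka₃, ka₄, ka₅, ka₆⟩ := ka
  obtain ⟨ka'₁, ka'₂, ka'₃, ka'₄, ka'₅, ka'₆⟩ := ka'
  obtain ⟨kb₁, kb₂, kb₃, kb₄, kb₅, kb₆⟩ := kb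
  obtain ⟨kb'₁, kb'₂, kb'₃, kb'₄, kb'₅, kb'₆⟩ := kb'
  have hAtb : (H (dx 1) (du 1)).2 0 = 0 := by
    linear_combination (jb₃ - jb'₃) / 2
  have hCtb : (H (dx 1) (du 1)).2 2 = 0 := by
    have : a * (H (dx 1) (du 1)).2 2 = 0 := by linear_combination -(jb₄ - jb'₄) / 2 + 2 * c * hAtb
    simpa [ha] using this
  have hAxb : (H (dx 0) (du 1)).2 0 = 0 := by
    linear_combination (kb₃ - kb'₃) / 2 - 2 * hCtb
  have hXtt : (H (dx 1) (dx 1)).1 0 = 0 := by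
    linear_combination (jb₁ - jb'₁) / 2 - 2 * hAxb
  have hBxa : (H (dx 0) (du 0)).2 1 = 0 := by
    linear_combination (ka₂ - ka'₂) / 2
  have hCxa : (H (dx 0) (du 0)).2 2 = 0 := by
    have : b * (H (dx 0) (du 0)).2 2 = 0 := by linear_combination -(ka₆ - ka'₆) / 2 + 2 * c * hBxa
    simpa [hb] using this
  have hBta : (H (dx 1) (du 0)).2 1 = 0 := by
    linear_combination (ja₂ - ja'₂) / 2 - 2 * hCxa
  have hTxx : (H (dx 0) (dx 0)).1 1 = 0 := by
    linear_combination -(ka₁ - ka'₁) / 2 - 2 * hBta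
  have hCta : (H (dx 1) (du 0)).2 2 = 0 := by
    have : c * (H (dx 1) (du 0)).2 2 = 0 := by linear_combination -(ja₅ - ja'₅) / 2 + c * (ja₁ - ja'₁) / 2 - 2 * a * hCxa
    simpa [hc] using this
  have hCxb : (H (dx 0) (du 1)).2 2 = 0 := by
    have : c * (H (dx 0) (du 1)).2 2 = 0 := by linear_combination -(kb₅ - kb'₅) / 2 - 2 * b * hCtb
    simpa [hc] using this
  have hCt : (L (dx 1)).2 2 = 0 := by
    linear_combination (ja₄ - ja'₄) / 2 - 2 * c * (ja₃ - ja'₃) / 2 + b * hXtt + a * hCta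
  have hCx : (L (dx 0)).2 2 = 0 := by
    linear_combination (kb₆ - kb'₆) / 2 - 2 * c * (kb₂ - kb'₂) / 2 + a * hTxx + b * hCxb
  have hAt : (L (dx 1)).2 0 = 0 := by
    linear_combination (kb₄ - kb'₄) / 2 - 2 * c * hAxb - 2 * b * hAtb + a * hCxb
  have hBx : (L (dx 0)).2 1 = 0 := by
    linear_combination (ja₆ - ja'₆) / 2 - 2 * a * hBxa - 2 * c * hBta + b * hCta
  have hBt : (L (dx 1)).2 1 = 0 := by
    linear_combination (ka₄ - ka'₄) / 2 + hCx - 2 * c * ((ka₃ - ka'₃) / 2 - 2 * hCta)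
      - b * (2 * ((ja₃ - ja'₃) / 2) - 2 * ((jb₂ - jb'₂) / 2 - 2 * hCxb) - (kb₁ - kb'₁) / 2) + a * hCxa
  have hAx : (L (dx 0)).2 0 = 0 := by
    linear_combination (jb₆ - jb'₆) / 2 + hCt
      - a * (2 * ((kb₂ - kb'₂) / 2) - 2 * ((ka₃ - ka'₃) / 2 - 2 * hCta) + (ja₁ - ja'₁) / 2)
      - 2 * c * ((jb₂ - jb'₂) / 2 - 2 * hCxb) + b * hCtb
  fin_cases i <;> fin_cases α <;> assumption

/-- The undifferentiated `φ₁` multiplies `b₁₁` in the linearized sixth equation and `φ₂` multiplies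
`a₂₂` in the fourth, so jets with these entries nonzero determine both. -/
theorem PointwiseSymmetry.value (h : PointwiseSymmetry z v L 0) (hL : L ∈ symmetryLinear)
    (ha : z.2 0 ≠ 0) (hb : z.2 1 ≠ 0) :
    v.2 0 = (L (du 0)).2 0 * z.2 0 + 2 * (L (dx 1)).1 0 * z.2 2 ∧
      v.2 1 = (L (du 1)).2 1 * z.2 1 + 2 * (L (dx 0)).1 1 * z.2 2 := by
  obtain ⟨h₁, h₂, h₃, h₄, h₅, h₆, h₇, h₈, h₉, h₁₀⟩ := hL
  generalize ha' : z.2 0 = a at *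
  generalize hb' : z.2 1 = b at *
  generalize hc' : z.2 2 = c at *
  have j := h ![![0, 0, a], ![0, 0, 0]] ![![0, a, 0], ![0, 0, 0], ![0, 0, 0]]
    (by intro ν; fin_cases ν <;> simp [system, ha', hb', hc']; ring) 5
  have k := h ![![0, 0, 0], ![0, 0, b]] ![![0, 0, 0], ![0, 0, 0], ![b, 0, 0]]
    (by intro ν; fin_cases ν <;> simp [system, ha', hb', hc']; ring) 3
  simp [linearizedSystem, prolongVec, firstCoeff, secondCoeff, map_pt, shift_zero_zero,
    shift_zero_one, shift_one_zero, shift_one_one, ha', hb', hc', h₁, h₂, h₃, h₄, h₅, h₆, h₇, h₈,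
    h₉, h₁₀] at j k
  constructor
  · refine mul_left_cancel₀ ha ?_
    linear_combination j
  · refine mul_left_cancel₀ hb ?_
    linear_combination k - b * b * h₃

/-! ### From generic points to the whole open set -/

theorem _root_.HasFDerivAt.apply_mem_of_eventually_mem {E F : Type*} [NormedAddCommGroup E]
    [NormedSpace ℝ E] [NormedAddCommGroup F] [NormedSpace ℝ F] [FiniteDimensional ℝ F]
    {S : Submodule ℝ F} {f : E → F} {f' : E →L[ℝ] F} {e : E} (hf : HasFDerivAt f f' e)
    (h : ∀ᶠ y in nhds e, f y ∈ S) (w : E) : f' w ∈ S := by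
  by_contra hw
  obtain ⟨g, hg, hS⟩ := Submodule.exists_le_ker_of_notMem hw
  have h₁ : HasFDerivAt (fun y => g.toContinuousLinearMap (f y))
      (g.toContinuousLinearMap.comp f') e :=
    g.toContinuousLinearMap.hasFDerivAt.comp e hf
  have h₂ : HasFDerivAt (fun y => g.toContinuousLinearMap (f y)) (0 : E →L[ℝ] ℝ) e :=
    (hasFDerivAt_const (0 : ℝ) e).congr_of_eventuallyEq (h.mono fun y hy => hS hy)
  exact hg (by simpa using congr($(h₁.unique h₂) w))

/-- The linear maps whose independent components do not depend on the dependent variables. -/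
def projectableLinear : Submodule ℝ (Pt →L[ℝ] Pt) where
  carrier := {L | ∀ β l, (L (du β)).1 l = 0}
  add_mem' h k := fun β l => by simp [h β l, k β l]
  zero_mem' := by simp
  smul_mem' r L h := fun β l => by simp [h β l]

/-- The points at which the determining equations are nondegenerate. -/
def generic : Set Pt :=
  {z | z.2 0 ≠ 0 ∧ z.2 1 ≠ 0 ∧ z.2 2 ≠ 0 ∧ z.2 0 * z.2 1 - z.2 2 ^ 2 ≠ 0}

theorem isOpen_generic : IsOpen generic := by
  have h (f : Pt → ℝ) (hf : Continuous f) : IsOpen {z | f z ≠ 0} := isOpen_ne_fun hf continuous_const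
  exact (h _ (by fun_prop)).inter ((h _ (by fun_prop)).inter
    ((h _ (by fun_prop)).inter (h _ (by fun_prop))))

open Polynomial in
theorem dense_generic : Dense generic := by
  intro z
  set a := z.2 0 with ha
  set b := z.2 1 with hb
  set c := z.2 2 with hc
  -- Along the direction `(1, 1, 2)` all four genericity conditions are nonzero polynomials; the
  -- last has leading coefficient `1 - 4`. Hence only finitely many points of the line are excluded.
  let P : ℝ[X] := (C a + X) * ((C b + X) * ((C c + 2 * X) *
    ((C a + X) * (C b + X) - (C c + 2 * X) ^ 2)))
  have hP : P ≠ 0 := by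
    have h (Q : ℝ[X]) (s : ℝ) (hs : Q.eval s ≠ 0) : Q ≠ 0 := by rintro rfl; simp at hs
    refine mul_ne_zero (h _ (1 - a) (by simp)) (mul_ne_zero (h _ (1 - b) (by simp))
      (mul_ne_zero (h _ ((1 - c) / 2) (by simp; linarith)) fun h0 => ?_))
    have h₀ := congr(($h0).eval 0)
    have h₁ := congr(($h0).eval 1)
    have h₂ := congr(($h0).eval (-1))
    simp at h₀ h₁ h₂
    linarith
  have hd : Dense ((P.roots.toFinset : Set ℝ)ᶜ) := by
    simpa [Set.compl_eq_univ_sdiff] using (dense_univ (X := ℝ)).sdiff_finset P.roots.toFinset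
  have hcont : Continuous fun s : ℝ => z + s • ((0, ![1, 1, 2]) : Pt) := by fun_prop
  have hm := hcont.range_subset_closure_image_dense hd ⟨0, rfl⟩
  simp only [zero_smul, add_zero] at hm
  refine closure_mono ?_ hm
  rintro _ ⟨s, hs, rfl⟩
  have hs' : P.eval s ≠ 0 := by simpa [hP] using hs
  simp only [P, eval_mul, eval_add, eval_sub, eval_pow, eval_C, eval_X, eval_ofNat, ne_eq,
    mul_eq_zero, not_or] at hs'
  simpa [generic, ← ha, ← hb, ← hc, mul_comm s 2] using hs'

section

variable {U : Set Pt} {X : Pt → Pt}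

theorem IsInfinitesimalSymmetry.hasFDerivAt_fderiv (h : IsInfinitesimalSymmetry U X)
    (hU : IsOpen U) {z : Pt} (hz : z ∈ U) :
    HasFDerivAt (fderiv ℝ X) (fderiv ℝ (fderiv ℝ X) z) z :=
  (((h.1.contDiffAt (hU.mem_nhds hz)).fderiv_right (m := 1) (by norm_cast)).differentiableAt
      (by simp)).hasFDerivAt

theorem IsInfinitesimalSymmetry.symm_fderiv (h : IsInfinitesimalSymmetry U X)
    (hU : IsOpen U) {z : Pt} (hz : z ∈ U) (u w : Pt) :
    fderiv ℝ (fderiv ℝ X) z u w = fderiv ℝ (fderiv ℝ X) z w u :=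
  (h.1.contDiffAt (hU.mem_nhds hz)).isSymmSndFDerivAt (by
    rw [minSmoothness_of_isRCLikeNormedField]; exact WithTop.coe_le_coe.2 le_top) u w

theorem IsInfinitesimalSymmetry.fderiv_mem_symmetryLinear (h : IsInfinitesimalSymmetry U X)
    (hU : IsOpen U) {z : Pt} (hz : z ∈ U ∩ generic) : fderiv ℝ X z ∈ symmetryLinear := by
  have hp := ((isInfinitesimalSymmetry_iff hU).1 h).2
  obtain ⟨ha, hb, hc, hd⟩ := hz.2
  have hH : ∀ w, fderiv ℝ (fderiv ℝ X) z w ∈ projectableLinear :=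
    (h.hasFDerivAt_fderiv hU hz.1).apply_mem_of_eventually_mem
      (((hU.inter isOpen_generic).eventually_mem hz).mono fun y hy =>
        (hp y hy.1).indep_du hy.2.1 hy.2.2.1)
  have hL := (hp z hz.1).indep_du ha hb
  exact ⟨hL, (hp z hz.1).dep_dx ha hb hc (h.symm_fderiv hU hz.1) hL hH,
    ((hp z hz.1).firstOrder ha hb hc hd).1⟩

/-- A nonzero second derivative would stay nonzero nearby, hence at some generic point, where it
lies in the vanishing first prolongation of `symmetryLinear`. -/
theorem IsInfinitesimalSymmetry.fderiv_fderiv_eq_zero (h : IsInfinitesimalSymmetry U X)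
    (hU : IsOpen U) {z : Pt} (hz : z ∈ U) : fderiv ℝ (fderiv ℝ X) z = 0 := by
  by_contra hne
  have hcont : ContinuousOn (fderiv ℝ (fderiv ℝ X)) U :=
    ((h.1.fderiv_of_isOpen hU (m := 1) (by norm_cast)).continuousOn_fderiv_of_isOpen hU (by simp))
  have hev : ∀ᶠ y in nhds z, fderiv ℝ (fderiv ℝ X) y ≠ 0 ∧ y ∈ U :=
    (((hcont z hz).continuousAt (hU.mem_nhds hz)).eventually_ne hne).and (hU.eventually_mem hz)
  obtain ⟨y, ⟨hy, hyU⟩, hyG⟩ := mem_closure_iff_nhds.1 (dense_generic z) _ hev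
  refine hy (eq_zero_of_forall_mem_symmetryLinear (h.symm_fderiv hU hyU) ?_)
  exact (h.hasFDerivAt_fderiv hU hyU).apply_mem_of_eventually_mem
    (((hU.inter isOpen_generic).eventually_mem ⟨hyU, hyG⟩).mono fun w hw =>
      h.fderiv_mem_symmetryLinear hU hw)

theorem IsInfinitesimalSymmetry.exists_eq (h : IsInfinitesimalSymmetry U X) (hU : IsOpen U)
    (hconn : IsConnected U) : ∃ k₁ k₂ k₃ k₄ k₅ k₆ k₇ : ℝ, ∀ z ∈ U,
      X z = symmetryField k₁ k₂ k₃ k₄ k₅ k₆ k₇ z := by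
  obtain ⟨z₀, hz₀, hG⟩ := dense_generic.inter_open_nonempty U hU hconn.nonempty
  have hdX : DifferentiableOn ℝ X U := h.1.differentiableOn (by simp)
  have hconst : ∀ z ∈ U, fderiv ℝ X z = fderiv ℝ X z₀ := fun z hz =>
    hU.is_const_of_fderiv_eq_zero (𝕜 := ℝ) hconn.isPreconnected
      (fun y hy => (h.hasFDerivAt_fderiv hU hy).differentiableAt.differentiableWithinAt)
      (fun y hy => h.fderiv_fderiv_eq_zero hU hy) hz hz₀
  have hp := ((isInfinitesimalSymmetry_iff hU).1 h).2 z₀ hz₀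
  have hmem := h.fderiv_mem_symmetryLinear hU ⟨hz₀, hG⟩
  obtain ⟨ha, hb, hc, hd⟩ := hG
  have hr := (hp.firstOrder ha hb hc hd).2
  rw [h.fderiv_fderiv_eq_zero hU hz₀] at hp
  obtain ⟨hA, hB⟩ := hp.value hmem ha hb
  set L := fderiv ℝ X z₀ with hL
  -- The relation `hr` from `firstOrder` gives `φ₃` once `φ₁` is known.
  have hC : (X z₀).2 2 = (L (du 2)).2 2 * z₀.2 2 + (L (dx 0)).1 1 * z₀.2 0
      + (L (dx 1)).1 0 * z₀.2 1 := by
    refine mul_left_cancel₀ ha ?_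
    linear_combination hr + z₀.2 2 * hA
  have haff : ∀ z ∈ U, X z = X z₀ + (L z - L z₀) := fun z hz => by
    have := hU.is_const_of_fderiv_eq_zero (𝕜 := ℝ) (f := fun y => X y - L y)
      hconn.isPreconnected (hdX.sub L.differentiable.differentiableOn)
      (fun y hy => by
        rw [fderiv_fun_sub (hdX.differentiableAt (hU.mem_nhds hy)) L.differentiableAt, hconst y hy]
        simp) hz hz₀
    rw [← sub_eq_iff_eq_add', ← sub_eq_zero]
    rw [← sub_eq_zero] at this
    rw [← this]
    abel
  obtain ⟨h₁, h₂, h₃, h₄, h₅, h₆, h₇, h₈, h₉, h₁₀⟩ := hmem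
  refine ⟨(L (dx 1)).1 0, (X z₀).1 0 - (L (dx 0)).1 0 * z₀.1 0 - (L (dx 1)).1 0 * z₀.1 1,
    (L (dx 0)).1 0, (L (dx 1)).1 1,
    (X z₀).1 1 - (L (dx 0)).1 1 * z₀.1 0 - (L (dx 1)).1 1 * z₀.1 1,
    (L (dx 0)).1 1, (L (du 0)).2 0, fun z hz => ?_⟩
  rw [haff z hz]
  obtain ⟨r, s⟩ := z
  obtain ⟨r₀, s₀⟩ := z₀
  simp only [map_pt]
  ext i
  · fin_cases i <;> simp [symmetryField, h₁] <;> ring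
  · fin_cases i <;> simp [symmetryField, h₂, h₃, h₄, h₅, h₆, h₇, h₈, h₉, h₁₀] at hA hB hC ⊢
    · linear_combination hA
    · linear_combination hB
    · linear_combination hC

end

/-! ### Converse and closure under the bracket -/

theorem pointwiseSymmetry_of_mem {z v : Pt} {L : Pt →L[ℝ] Pt} (hL : L ∈ symmetryLinear)
    (hA : v.2 0 = (L (du 0)).2 0 * z.2 0 + 2 * (L (dx 1)).1 0 * z.2 2)
    (hB : v.2 1 = (L (du 1)).2 1 * z.2 1 + 2 * (L (dx 0)).1 1 * z.2 2)
    (hC : v.2 2 = (L (du 2)).2 2 * z.2 2 + (L (dx 0)).1 1 * z.2 0 + (L (dx 1)).1 0 * z.2 1) :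
    PointwiseSymmetry z v L 0 := by
  obtain ⟨h₁, h₂, h₃, h₄, h₅, h₆, h₇, h₈, h₉, h₁₀⟩ := hL
  intro p q hs
  have s₁ := hs 0
  have s₂ := hs 1
  have s₃ := hs 2
  have s₄ := hs 3
  have s₅ := hs 4
  have s₆ := hs 5
  clear hs
  simp [system] at s₁ s₂ s₃ s₄ s₅ s₆
  simp [Fin.forall_fin_succ, linearizedSystem, prolongVec, firstCoeff, secondCoeff, map_pt,
    shift_zero_zero, shift_zero_one, shift_one_zero, shift_one_one, h₁, h₂, h₃, h₄, h₅, h₆, h₇, h₈,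
    h₉, h₁₀, hA, hB, hC]
  generalize (L (dx 0)).1 0 = k₃
  generalize (L (dx 1)).1 0 = k₁
  generalize (L (dx 0)).1 1 = k₆
  generalize (L (dx 1)).1 1 = k₄
  generalize (L (du 0)).2 0 = k₇
  refine ⟨?_, ?_, ?_, ?_, ?_, ?_⟩
  -- The coefficients describe the infinitesimal action on the equations: scalings multiply each
  -- one, and `k₁`, `k₆` mix them.
  · linear_combination (k₇ - 2 * k₃) * s₁ + 2 * k₁ * s₂ - 2 * k₆ * s₃
  · linear_combination (k₇ - 3 * k₃ + k₄) * s₂ + k₆ * s₁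
  · linear_combination (k₇ - k₃ - k₄) * s₃ - k₁ * s₁
  · linear_combination (2 * k₇ - 2 * k₃) * s₄ - 2 * k₁ * s₅ - z.2 0 * k₁ * s₂ + z.2 0 * k₆ * s₃
  · linear_combination (2 * k₇ + k₄ - 3 * k₃) * s₅ - k₁ * s₆ - k₆ * s₄ + k₁ * z.2 2 * s₂
      + k₁ * z.2 1 * s₁ - k₆ * z.2 2 * s₃
  · linear_combination (2 * k₇ + 2 * k₄ - 4 * k₃) * s₆ - 2 * k₆ * s₅ + k₁ * z.2 1 * s₂
      + 2 * z.2 2 * k₆ * s₁ - k₆ * z.2 1 * s₃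

/-- The linear part of `symmetryField k₁ ... k₇`. -/
noncomputable def symmetryFieldLinear (k₁ k₃ k₄ k₆ k₇ : ℝ) : Pt →L[ℝ] Pt :=
  LinearMap.toContinuousLinearMap
    { toFun := symmetryField k₁ 0 k₃ k₄ 0 k₆ k₇
      map_add' := fun z w => by
        ext i <;> fin_cases i <;> simp [symmetryField] <;> ring
      map_smul' := fun r z => by
        ext i <;> fin_cases i <;> simp [symmetryField] <;> ring }

theorem symmetryFieldLinear_apply (k₁ k₃ k₄ k₆ k₇ : ℝ) (z : Pt) :
    symmetryFieldLinear k₁ k₃ k₄ k₆ k₇ z = symmetryField k₁ 0 k₃ k₄ 0 k₆ k₇ z := rfl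

theorem symmetryField_eq (k₁ k₂ k₃ k₄ k₅ k₆ k₇ : ℝ) (z : Pt) :
    symmetryField k₁ k₂ k₃ k₄ k₅ k₆ k₇ z =
      symmetryFieldLinear k₁ k₃ k₄ k₆ k₇ z + (![k₂, k₅], 0) := by
  rw [symmetryFieldLinear_apply]
  ext i <;> fin_cases i <;> simp [symmetryField]

theorem symmetryFieldLinear_mem (k₁ k₃ k₄ k₆ k₇ : ℝ) :
    symmetryFieldLinear k₁ k₃ k₄ k₆ k₇ ∈ symmetryLinear := by
  refine ⟨fun β l => ?_, fun i α => ?_, ?_, ?_, ?_, ?_, ?_, ?_, ?_, ?_⟩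
  · fin_cases β <;> fin_cases l <;> simp [symmetryFieldLinear_apply, symmetryField, du]
  · fin_cases i <;> fin_cases α <;> simp [symmetryFieldLinear_apply, symmetryField, dx]
  all_goals simp [symmetryFieldLinear_apply, symmetryField, dx, du]
  all_goals ring

theorem hasFDerivAt_symmetryField (k₁ k₂ k₃ k₄ k₅ k₆ k₇ : ℝ) (z : Pt) :
    HasFDerivAt (symmetryField k₁ k₂ k₃ k₄ k₅ k₆ k₇) (symmetryFieldLinear k₁ k₃ k₄ k₆ k₇) z := by
  have := (symmetryFieldLinear k₁ k₃ k₄ k₆ k₇).hasFDerivAt (x := z) |>.add_const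
    ((![k₂, k₅], 0) : Pt)
  rwa [← funext (symmetryField_eq k₁ k₂ k₃ k₄ k₅ k₆ k₇)] at this

section

variable {U : Set Pt} {X : Pt → Pt} {k₁ k₂ k₃ k₄ k₅ k₆ k₇ : ℝ}

theorem fderiv_eq_symmetryFieldLinear (hU : IsOpen U)
    (h : ∀ z ∈ U, X z = symmetryField k₁ k₂ k₃ k₄ k₅ k₆ k₇ z) {z : Pt} (hz : z ∈ U) :
    fderiv ℝ X z = symmetryFieldLinear k₁ k₃ k₄ k₆ k₇ :=
  (Filter.EventuallyEq.fderiv_eq ((hU.eventually_mem hz).mono h)).trans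
    (hasFDerivAt_symmetryField ..).fderiv

theorem isInfinitesimalSymmetry_of_eq (hU : IsOpen U)
    (h : ∀ z ∈ U, X z = symmetryField k₁ k₂ k₃ k₄ k₅ k₆ k₇ z) : IsInfinitesimalSymmetry U X := by
  refine (isInfinitesimalSymmetry_iff hU).2 ⟨?_, fun z hz => ?_⟩
  · refine ContDiffOn.congr (f := symmetryField k₁ k₂ k₃ k₄ k₅ k₆ k₇) ?_ h
    rw [funext (symmetryField_eq k₁ k₂ k₃ k₄ k₅ k₆ k₇)]
    fun_prop
  · have h₂ : fderiv ℝ (fderiv ℝ X) z = 0 := by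
      have : fderiv ℝ X =ᶠ[nhds z] fun _ => symmetryFieldLinear k₁ k₃ k₄ k₆ k₇ :=
        (hU.eventually_mem hz).mono fun y hy => fderiv_eq_symmetryFieldLinear hU h hy
      rw [this.fderiv_eq]
      simp
    rw [h₂, fderiv_eq_symmetryFieldLinear hU h hz, h z hz]
    apply pointwiseSymmetry_of_mem (symmetryFieldLinear_mem k₁ k₃ k₄ k₆ k₇)
    all_goals simp [symmetryFieldLinear_apply, symmetryField, dx, du]
    all_goals ring

/-- For affine fields with linear parts `A`, `M` the bracket is affine with linear part `M A - A M`;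
the parameters are read off from its entries and from the translation part. -/
theorem lieBracket_eq_symmetryField (hU : IsOpen U) {Y : Pt → Pt} {m₁ m₂ m₃ m₄ m₅ m₆ m₇ : ℝ}
    (hX : ∀ z ∈ U, X z = symmetryField k₁ k₂ k₃ k₄ k₅ k₆ k₇ z)
    (hY : ∀ z ∈ U, Y z = symmetryField m₁ m₂ m₃ m₄ m₅ m₆ m₇ z) :
    ∀ z ∈ U, VectorField.lieBracket ℝ X Y z = symmetryField
      (m₃ * k₁ + m₁ * k₄ - k₃ * m₁ - k₁ * m₄) (m₃ * k₂ + m₁ * k₅ - k₃ * m₂ - k₁ * m₅)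
      (m₁ * k₆ - k₁ * m₆) (m₆ * k₁ - k₆ * m₁) (m₆ * k₂ + m₄ * k₅ - k₆ * m₂ - k₄ * m₅)
      (m₆ * k₃ + m₄ * k₆ - k₆ * m₃ - k₄ * m₆) (2 * m₁ * k₆ - 2 * k₁ * m₆) z := by
  intro z hz
  rw [VectorField.lieBracket, fderiv_eq_symmetryFieldLinear hU hX hz,
    fderiv_eq_symmetryFieldLinear hU hY hz, hX z hz, hY z hz, symmetryFieldLinear_apply,
    symmetryFieldLinear_apply]
  ext i <;> fin_cases i <;> simp [symmetryField] <;> ring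

end

theorem isInfinitesimalSymmetry_iff_exists {U : Set Pt} (hU : IsOpen U) (hconn : IsConnected U)
    (X : Pt → Pt) : IsInfinitesimalSymmetry U X ↔ ∃ k₁ k₂ k₃ k₄ k₅ k₆ k₇ : ℝ, ∀ z ∈ U,
      X z = symmetryField k₁ k₂ k₃ k₄ k₅ k₆ k₇ z :=
  ⟨fun h => h.exists_eq hU hconn,
    fun ⟨_, _, _, _, _, _, _, h⟩ => isInfinitesimalSymmetry_of_eq hU h⟩

/-! ### Dimension seven -/

/-- The family of vector fields `symmetryField k₁ ... k₇`, restricted to `U`, as a linear map of the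
parameters. -/
def symmetryFamily (U : Set Pt) : (Fin 7 → ℝ) →ₗ[ℝ] (U → Pt) where
  toFun k z := symmetryField (k 0) (k 1) (k 2) (k 3) (k 4) (k 5) (k 6) z
  map_add' k m := by
    ext z i <;> fin_cases i <;> simp [symmetryField] <;> ring
  map_smul' r k := by
    ext z i <;> fin_cases i <;> simp [symmetryField] <;> ring

/-- The derivative at a point of `U` recovers the five linear parameters, and then the value there
recovers `k₂` and `k₅`. -/
theorem symmetryFamily_injective {U : Set Pt} (hU : IsOpen U) (hne : U.Nonempty) :
    Function.Injective (symmetryFamily U) := by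
  rw [← LinearMap.ker_eq_bot, LinearMap.ker_eq_bot']
  intro k hk
  obtain ⟨z, hz⟩ := hne
  have h0 : ∀ y ∈ U, (0 : Pt → Pt) y =
      symmetryField (k 0) (k 1) (k 2) (k 3) (k 4) (k 5) (k 6) y := fun y hy =>
    (congrFun hk ⟨y, hy⟩).symm
  have hL := fderiv_eq_symmetryFieldLinear hU h0 hz
  rw [fderiv_zero] at hL
  have hx₀ := congr($hL (dx 0))
  have hx₁ := congr($hL (dx 1))
  have hu := congr($hL (du 0))
  have hv := h0 z hz
  simp only [symmetryFieldLinear_apply] at hx₀ hx₁ hu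
  simp [symmetryField, dx, du, Prod.ext_iff, funext_iff, Fin.forall_fin_succ] at hx₀ hx₁ hu
  simp [symmetryField, Prod.ext_iff, funext_iff, Fin.forall_fin_succ] at hv
  obtain ⟨⟨h₃, h₆⟩, ⟨h₁, h₄⟩, h₇, -⟩ := And.intro hx₀ (And.intro hx₁ hu)
  obtain ⟨⟨h₂, h₅⟩, -⟩ := hv
  rw [← h₃, ← h₁, zero_mul, zero_mul, zero_add, zero_add] at h₂
  rw [← h₆, ← h₄, zero_mul, zero_mul, zero_add, zero_add] at h₅
  ext i
  fin_cases i
  exacts [h₁.symm, h₂.symm, h₃.symm, h₄.symm, h₅.symm, h₆.symm, h₇.symm]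

end WalkerSymmetry

theorem theorem3p1 (U : Set WalkerSymmetry.Pt) (hU : IsOpen U) (hconn : IsConnected U) :
    (∀ X : WalkerSymmetry.Pt → WalkerSymmetry.Pt,
      WalkerSymmetry.IsInfinitesimalSymmetry U X ↔
        ∃ k₁ k₂ k₃ k₄ k₅ k₆ k₇ : ℝ, ∀ z ∈ U,
          X z = WalkerSymmetry.symmetryField k₁ k₂ k₃ k₄ k₅ k₆ k₇ z) ∧
    (∀ X Y : WalkerSymmetry.Pt → WalkerSymmetry.Pt,
      WalkerSymmetry.IsInfinitesimalSymmetry U X →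
      WalkerSymmetry.IsInfinitesimalSymmetry U Y →
        WalkerSymmetry.IsInfinitesimalSymmetry U (VectorField.lieBracket ℝ X Y)) ∧
    (∃ 𝔤 : Submodule ℝ (U → WalkerSymmetry.Pt),
      (∀ Y : U → WalkerSymmetry.Pt, Y ∈ 𝔤 ↔
        ∃ X : WalkerSymmetry.Pt → WalkerSymmetry.Pt,
          WalkerSymmetry.IsInfinitesimalSymmetry U X ∧ ∀ z : U, Y z = X z) ∧
      Module.finrank ℝ 𝔤 = 7) := by
  open WalkerSymmetry in
  refine ⟨isInfinitesimalSymmetry_iff_exists hU hconn, fun X Y hX hY => ?_,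
    LinearMap.range (symmetryFamily U), fun Y => ⟨?_, ?_⟩, ?_⟩
  · obtain ⟨_, _, _, _, _, _, _, hX⟩ := hX.exists_eq hU hconn
    obtain ⟨_, _, _, _, _, _, _, hY⟩ := hY.exists_eq hU hconn
    exact isInfinitesimalSymmetry_of_eq hU (lieBracket_eq_symmetryField hU hX hY)
  · rintro ⟨k, rfl⟩
    exact ⟨symmetryField (k 0) (k 1) (k 2) (k 3) (k 4) (k 5) (k 6),
      isInfinitesimalSymmetry_of_eq hU fun _ _ => rfl, fun _ => rfl⟩
  · rintro ⟨X, hX, hY⟩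
    obtain ⟨k₁, k₂, k₃, k₄, k₅, k₆, k₇, hX⟩ := hX.exists_eq hU hconn
    exact ⟨![k₁, k₂, k₃, k₄, k₅, k₆, k₇], funext fun z => by
      rw [hY, hX z z.2]; simp [symmetryFamily]⟩
  · rw [LinearMap.finrank_range_of_inj (symmetryFamily_injective hU hconn.nonempty)]
    simp
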